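/- **Proposition 2.2.** A plane partition is a finite set $\pi\subset\mathbb N^3$ (where $\mathbb N=\{0,1,2,\dots\}$) such that $(i,j,k)\in\pi$, $i'\le i$, $j'\le j$, $k'\le k$ imply $(i',j',k')\in\pi$. For $m\ge 0$ let $CSSC(m)$ be the number of plane partitions $\pi$ contained in the cube $B=\{(i,j,k)\in\mathbb N^3: i,j,k<m\}$ that are cyclically symmetric, i.e. $\{(j,k,i):(i,j,k)\in\pi\}=\pi$, and self-complementary, i.e. $\{(i,j,k)\in B:(m-i-1,\,m-j-1,\,m-k-1)\notin\pi\}=\pi$. For $n\ge 0$ let $U(n)$ be the $n\times n$ matrix $$U(n)=\left(\frac12\binom{i+j}{2i-j}+\binom{i+j}{2i-j-1}\right)_{0\le i,j\le n-1},$$ where $\binom{a}{b}=0$ if $b<0$ or $b>a$. Then $$CSSC(2n)=2^n\det U(n).$$ (For $n=0$ the empty determinant is $1$.) -/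

import Mathlib

namespace PlanePartition

/-- The box `B(a,b,c) = {(i,j,k) ∈ ℕ³ : i < a, j < b, k < c}`. -/
def box (a b c : ℕ) : Finset (ℕ × ℕ × ℕ) :=
  Finset.range a ×ˢ Finset.range b ×ˢ Finset.range c

/-- A plane partition, seen as a finite order ideal of `ℕ³`: a finite set that contains, together
with a point, all points of `ℕ³` that are coordinatewise smaller. -/
def IsPlanePartition (π : Finset (ℕ × ℕ × ℕ)) : Prop :=
  ∀ i j k i' j' k' : ℕ, (i, j, k) ∈ π → i' ≤ i → j' ≤ j → k' ≤ k → (i', j', k') ∈ π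

/-- The symmetry `π ↦ π^r`: the coordinate axes are permuted cyclically. -/
def rotate (π : Finset (ℕ × ℕ × ℕ)) : Finset (ℕ × ℕ × ℕ) :=
  π.image fun p => (p.2.1, p.2.2, p.1)

/-- The symmetry `π ↦ π^c`, complementation in the box `B(a,b,c)`: the points `(i,j,k)` of the box
whose opposite point `(a-i-1, b-j-1, c-k-1)` is not in `π`. -/
def compl (a b c : ℕ) (π : Finset (ℕ × ℕ × ℕ)) : Finset (ℕ × ℕ × ℕ) :=
  (box a b c).filter fun p => (a - p.1 - 1, b - p.2.1 - 1, c - p.2.2 - 1) ∉ π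

open Classical in
/-- `CSSC m` is the number of cyclically symmetric, self-complementary plane partitions contained
in the cube `B(m,m,m)`, that is, of those with `π^r = π^c = π`. -/
noncomputable def CSSC (m : ℕ) : ℕ :=
  ((box m m m).powerset.filter fun π =>
    IsPlanePartition π ∧ rotate π = π ∧ compl m m m π = π).card

/-- The binomial coefficient `C(m, k)` for a natural number `m` and an integer `k`; it is zero for
negative `k`. -/
def binom (m : ℕ) (k : ℤ) : ℕ :=
  if 0 ≤ k then m.choose k.toNat else 0

/-- The matrix `U(n) = (1/2 * C(i+j, 2i-j) + C(i+j, 2i-j-1))`, `0 ≤ i, j ≤ n-1`. -/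
def U (n : ℕ) : Matrix (Fin n) (Fin n) ℚ :=
  Matrix.of fun i j =>
    (1 / 2 : ℚ) * (binom ((i : ℕ) + (j : ℕ)) (2 * ((i : ℕ) : ℤ) - ((j : ℕ) : ℤ)) : ℚ) +
      (binom ((i : ℕ) + (j : ℕ)) (2 * ((i : ℕ) : ℤ) - ((j : ℕ) : ℤ) - 1) : ℚ)

end PlanePartition

/-!
A plane partition `π` in the cube of side `m = 2n` is a lozenge tiling of a hexagon, and it is
cyclically symmetric and self-complementary exactly if the tiling is invariant under the rotation
by 60 degrees. It is then determined by the tiling of one sector, which is encoded by `n`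
nonintersecting lattice paths that cross the sector from one side to the other. In terms of
particles: at time `c` a particle at a position `≥ c` stays or moves up by one, and a particle
below `c` has left the sector and is frozen. The two sides of the sector fit together under the
rotation if and only if the final positions are the complement of the initial ones (`IsSector`,
`card_isSector_eq_CSSC`). The bijection goes through the numbers of points of `π` on the lines in
the direction `(1, 1, 1)`, which are expressed by the numbers of particles at positions `≥ a` at
time `c` (`IsHeight`).

By the Lindström–Gessel–Viennot lemma (`card_paths`, proved by applying the Cauchy–Binet formula
to the product of the one-step transfer matrices), there are `det (C(y_l, x_k))` path systems from
the set `x` to the set `y`. Hence `CSSC(2n)` is the sum of these minors over all `n`-element sets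
`x` in `{0, …, 2n-1}` with complement `y`.

Up to the signs `(-1)^s`, the Pascal matrix `(C(s, t))` is the matrix `E` of the involution `p(X)
↦ p(-1 - X)`, with the eigenvectors `p_i = (X(X+1))^i` and `q_j = (X + 1/2)(X(X+1))^j` for the
eigenvalues `1` and `-1`. As `E + 1` vanishes on the `q_j`, and the off-diagonal blocks of `E` and
`E + 1` agree, the minor of `E` for complementary `x`, `y` is `±2^n` times the product of the
minors of the coefficient matrices of the `p_i` and of the `q_j` in the rows `x`
(`det_choose_shuffle`); the sign of the shuffle `(x, y)` cancels the signs `(-1)^s`. A second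
application of Cauchy–Binet sums these products to `2^n det (⟨p_i, q_j⟩)`, where `⟨·, ·⟩` pairs
the coefficients, and `⟨p_i, q_j⟩` is the entry of `U(n)` by Vandermonde's convolution
(`U_eq_mul`).
-/

namespace PlanePartition

open Finset Matrix

/-! ### The Cauchy–Binet formula -/

/-- The **Cauchy–Binet formula**: the minors are indexed by the order embeddings of `Fin n` into
the middle index type, that is, by its `n`-element subsets. -/
theorem det_mul_eq_sum_minors {R ι : Type*} [CommRing R] [Fintype ι] [LinearOrder ι] {n : ℕ}
    (A : Matrix (Fin n) ι R) (B : Matrix ι (Fin n) R) :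
    (A * B).det = ∑ x : Fin n ↪o ι, (A.submatrix id x).det * (B.submatrix x id).det := by
  classical
  have h1 : (A * B).det = ∑ p : Fin n → ι, (∏ k, A k (p k)) * (B.submatrix p id).det := by
    have h := (Matrix.detRowAlternating (n := Fin n) (R := R)).toMultilinearMap.map_sum
      (fun k i => A k i • B i)
    have h2 : (fun k => ∑ i, A k i • B i) = (A * B : Matrix (Fin n) (Fin n) R) := by
      ext k l
      simp [Matrix.mul_apply, Finset.sum_apply]
    rw [h2] at h
    refine h.trans (Finset.sum_congr rfl fun p _ => ?_)
    have h3 := (Matrix.detRowAlternating (n := Fin n) (R := R)).toMultilinearMap.map_smul_univ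
      (fun k => A k (p k)) (fun k => B (p k))
    exact h3
  have h2 : ∀ x : Fin n ↪o ι, (A.submatrix id x).det * (B.submatrix x id).det =
      ∑ σ : Equiv.Perm (Fin n), (∏ k, A k (x (σ k))) * (B.submatrix (x ∘ σ) id).det := by
    intro x
    rw [← Matrix.det_transpose, Matrix.det_apply', Finset.sum_mul]
    refine Finset.sum_congr rfl fun σ _ => ?_
    have h3 : (B.submatrix (x ∘ σ) id).det =
        (Equiv.Perm.sign σ : ℤ) * (B.submatrix x id).det := by
      rw [← Matrix.det_permute]
      rfl
    rw [h3]
    simp only [Matrix.transpose_apply, Matrix.submatrix_apply, id]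
    ring
  rw [h1]
  simp_rw [h2]
  rw [← Finset.sum_product']
  symm
  refine Finset.sum_of_injOn (fun q : (Fin n ↪o ι) × Equiv.Perm (Fin n) => (q.1 ∘ q.2 : Fin n → ι))
    ?_ (by simp) ?_ ?_
  · rintro ⟨x, σ⟩ _ ⟨y, τ⟩ _ h
    have hr : Set.range x = Set.range y := by
      have := congrArg Set.range h
      simpa using this
    have hxy : x = y := OrderEmbedding.range_inj.mp hr
    subst hxy
    simp only [Prod.mk.injEq, true_and]
    ext k
    have := congrFun h k
    simp only [Function.comp_apply, EmbeddingLike.apply_eq_iff_eq] at this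
    rw [this]
  · intro p _ hp
    by_cases hinj : Function.Injective p
    · refine absurd ?_ hp
      have hcard : (univ.image p).card = n := by
        rw [Finset.card_image_of_injective _ hinj, Finset.card_univ, Fintype.card_fin]
      let f := (univ.image p).orderIsoOfFin hcard
      let g : Fin n → Fin n := fun k => f.symm ⟨p k, by simp⟩
      have hg : Function.Injective g := by
        intro a b hab
        have := f.symm.injective hab
        exact hinj (by simpa using this)
      refine ⟨((univ.image p).orderEmbOfFin hcard,
        Equiv.ofBijective g (Finite.injective_iff_bijective.mp hg)), by simp, ?_⟩
      funext k
      have : f (g k) = ⟨p k, by simp⟩ := by simp [g]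
      simp only [Function.comp_apply, Equiv.ofBijective_apply]
      exact congrArg Subtype.val this
    · rw [Function.Injective] at hinj
      push Not at hinj
      obtain ⟨a, b, hab, hne⟩ := hinj
      rw [Matrix.det_zero_of_row_eq hne (by ext l; simp [hab]), mul_zero]
  · rintro ⟨x, σ⟩ _
    rfl

/-! ### The sign of a shuffle -/

/-- The sign of the shuffle that lists the values of `e ∘ inl` and then those of `e ∘ inr`, both
increasing: the inversions with second entry `y l` number `n + l - y l`. -/
theorem sign_shuffle {n : ℕ} (e : Fin n ⊕ Fin n ≃ Fin (n + n))
    (hx : StrictMono (e ∘ Sum.inl)) (hy : StrictMono (e ∘ Sum.inr)) :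
    Equiv.Perm.sign (finSumFinEquiv.symm.trans e) =
      (-1) ^ ∑ l : Fin n, ((l : ℕ) + n + (e (Sum.inr l) : ℕ)) := by
  classical
  -- Below `y l` there are `l` values of `y`, and all the other numbers are values of `x`.
  have hcount : ∀ l : Fin n, (e (Sum.inr l) : ℕ) =
      (univ.filter fun k => e (Sum.inl k) < e (Sum.inr l)).card + l := by
    intro l
    have h1 : (univ.filter fun i => i < e (Sum.inr l)).card = (e (Sum.inr l) : ℕ) := by
      rw [← Fin.card_Iio]
      congr 1
      ext; simp
    have h2 : (univ.filter fun r => e r < e (Sum.inr l)).card = (e (Sum.inr l) : ℕ) := by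
      rw [← h1]
      refine Finset.card_equiv e fun r => by simp
    rw [← h2, Finset.card_filter, Fintype.sum_sum_type, ← Finset.card_filter,
      ← Finset.card_filter]
    congr 1
    rw [← Fin.card_Iio l]
    congr 1
    ext l'
    simpa using hy.lt_iff_lt (a := l') (b := l)
  rw [Equiv.Perm.sign_eq_prod_prod_Ioi]
  have hIoi : ∀ i : Fin (n + n), Finset.Ioi i = univ.filter fun j => i < j := by
    intro i; ext; simp
  simp_rw [hIoi, Finset.prod_filter]
  rw [Fin.prod_univ_add]
  simp_rw [Fin.prod_univ_add]
  have hxx : ∀ k k' : Fin n, k < k' → e (Sum.inl k) < e (Sum.inl k') := fun k k' h => hx h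
  have hyy : ∀ k k' : Fin n, k < k' → e (Sum.inr k) < e (Sum.inr k') := fun k k' h => hy h
  have hs1 : ∀ k : Fin n, finSumFinEquiv.symm (Fin.castAdd n k) = Sum.inl k :=
    fun k => finSumFinEquiv_symm_apply_castAdd k
  have hs2 : ∀ k : Fin n, finSumFinEquiv.symm (Fin.natAdd n k) = Sum.inr k :=
    fun k => finSumFinEquiv_symm_apply_natAdd k
  have hlt : ∀ k l : Fin n, Fin.castAdd n k < Fin.natAdd n l := fun k l => by
    simp only [Fin.lt_def, Fin.val_castAdd, Fin.val_natAdd]; omega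
  have hA : ∀ k k' : Fin n, (if Fin.castAdd n k < Fin.castAdd n k' then
      (if e (Sum.inl k) < e (Sum.inl k') then (1 : ℤˣ) else -1) else 1) = 1 := by
    intro k k'
    split_ifs with h h2
    · rfl
    · exact absurd (hxx k k' h) h2
    · rfl
  have hD : ∀ k k' : Fin n, (if Fin.natAdd n k < Fin.natAdd n k' then
      (if e (Sum.inr k) < e (Sum.inr k') then (1 : ℤˣ) else -1) else 1) = 1 := by
    intro k k'
    split_ifs with h h2
    · rfl
    · exact absurd (hyy k k' (by simpa using h)) h2
    · rfl
  simp only [Equiv.trans_apply, hs1, hs2, hA, hD, hlt, (hlt _ _).not_gt, if_true, if_false,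
    Finset.prod_const_one, one_mul, mul_one]
  rw [Finset.prod_comm, ← Finset.prod_pow_eq_pow_sum]
  refine Finset.prod_congr rfl fun l _ => ?_
  rw [Finset.prod_ite]
  simp only [Finset.prod_const_one, one_mul, Finset.prod_const]
  have hc := Finset.card_filter_add_card_filter_not (s := univ)
    (fun k : Fin n => e (Sum.inl k) < e (Sum.inr l))
  rw [Finset.card_univ, Fintype.card_fin] at hc
  have h := hcount l
  apply neg_one_pow_congr
  rw [Nat.even_iff, Nat.even_iff]
  omega

/-! ### The involution `p(X) ↦ p(-1 - X)` and its eigenvectors -/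

section Reflection

open Polynomial

/-- The eigenvectors of `p(X) ↦ p(-1 - X)`: `(X(X+1))^i` for the eigenvalue `1` (index `inl i`)
and `(X + 1/2)(X(X+1))^j` for the eigenvalue `-1` (index `inr j`). -/
noncomputable def reflectionBasis : ℕ ⊕ ℕ → ℚ[X]
  | Sum.inl i => (X * (X + 1)) ^ i
  | Sum.inr j => (X + C (1 / 2)) * (X * (X + 1)) ^ j

/-- The degree of `reflectionBasis c`. -/
def reflectionDegree : ℕ ⊕ ℕ → ℕ
  | Sum.inl i => 2 * i
  | Sum.inr j => 2 * j + 1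

theorem reflectionBasis_monic (c : ℕ ⊕ ℕ) :
    (reflectionBasis c).Monic ∧ (reflectionBasis c).natDegree = reflectionDegree c := by
  have h1 : (X + 1 : ℚ[X]).Monic := by simpa using monic_X_add_C (1 : ℚ)
  have hd1 : (X + 1 : ℚ[X]).natDegree = 1 := by simpa using natDegree_X_add_C (1 : ℚ)
  have h2 : (X * (X + 1) : ℚ[X]).Monic := monic_X.mul h1
  have hd2 : (X * (X + 1) : ℚ[X]).natDegree = 2 := by
    rw [monic_X.natDegree_mul h1, hd1, natDegree_X]
  rcases c with i | j
  · refine ⟨h2.pow i, ?_⟩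
    simp only [reflectionBasis, reflectionDegree]
    rw [h2.natDegree_pow, hd2]; ring
  · refine ⟨(monic_X_add_C _).mul (h2.pow j), ?_⟩
    simp only [reflectionBasis, reflectionDegree]
    rw [(monic_X_add_C _).natDegree_mul (h2.pow j), h2.natDegree_pow, hd2, natDegree_X_add_C]
    ring

theorem reflectionBasis_inl_comp (i : ℕ) :
    (reflectionBasis (Sum.inl i)).comp (-1 - X) = reflectionBasis (Sum.inl i) := by
  simp only [reflectionBasis, pow_comp, mul_comp, add_comp, X_comp, one_comp]
  congr 1
  ring

theorem reflectionBasis_inr_comp (j : ℕ) :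
    (reflectionBasis (Sum.inr j)).comp (-1 - X) = -reflectionBasis (Sum.inr j) := by
  simp only [reflectionBasis, pow_comp, mul_comp, add_comp, X_comp, one_comp, C_comp]
  have h1 : (-1 - X + C (1 / 2) : ℚ[X]) = -(X + C (1 / 2)) := by
    have : (C (1 / 2) + C (1 / 2) : ℚ[X]) = 1 := by
      rw [← C_add]; norm_num
    linear_combination this
  have h2 : ((-1 - X) * (-1 - X + 1) : ℚ[X]) = X * (X + 1) := by ring
  rw [h1, h2]
  ring

/-- The matrix of `p(X) ↦ p(-1 - X)` in the monomial basis. -/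
def reflectionMatrix (m : ℕ) : Matrix (Fin m) (Fin m) ℚ :=
  Matrix.of fun t s => (-1) ^ (s : ℕ) * ((s : ℕ).choose t : ℚ)

theorem reflectionMatrix_mulVec_coeff {m : ℕ} (f : ℚ[X]) (hf : f.natDegree < m) (t : Fin m) :
    ∑ s : Fin m, reflectionMatrix m t s * f.coeff s = (f.comp (-1 - X)).coeff t := by
  have h1 : (-1 - X : ℚ[X]) = C (-1) * (X + 1) := by simp; ring
  have h : f.comp (-1 - X) = ∑ s ∈ range m, C (f.coeff s) * (-1 - X) ^ s := by
    rw [Polynomial.comp, eval₂_eq_sum_range' _ hf]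
  rw [h, finsetSum_coeff, ← Fin.sum_univ_eq_sum_range
    (fun s => (C (f.coeff s) * (-1 - X : ℚ[X]) ^ s).coeff t)]
  refine Finset.sum_congr rfl fun s _ => ?_
  rw [coeff_C_mul, h1, mul_pow, ← C_pow, coeff_C_mul, coeff_X_add_one_pow]
  simp only [reflectionMatrix, Matrix.of_apply]
  ring

/-- The coefficients of the eigenvectors of degree less than `2n`, in columns. -/
noncomputable def reflectionCoeff (n : ℕ) : Matrix (Fin (n + n)) (Fin n ⊕ Fin n) ℚ :=
  Matrix.of fun r c => (reflectionBasis (c.map Fin.val Fin.val)).coeff r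

theorem reflectionMatrix_mul_inl {n : ℕ} (t : Fin (n + n)) (i : Fin n) :
    ∑ s, reflectionMatrix (n + n) t s * reflectionCoeff n s (Sum.inl i) =
      reflectionCoeff n t (Sum.inl i) := by
  simp only [reflectionCoeff, Matrix.of_apply, Sum.map_inl]
  rw [reflectionMatrix_mulVec_coeff, reflectionBasis_inl_comp]
  rw [(reflectionBasis_monic _).2, reflectionDegree]
  omega

theorem reflectionMatrix_mul_inr {n : ℕ} (t : Fin (n + n)) (j : Fin n) :
    ∑ s, reflectionMatrix (n + n) t s * reflectionCoeff n s (Sum.inr j) =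
      -reflectionCoeff n t (Sum.inr j) := by
  simp only [reflectionCoeff, Matrix.of_apply, Sum.map_inr]
  rw [reflectionMatrix_mulVec_coeff, reflectionBasis_inr_comp, coeff_neg]
  rw [(reflectionBasis_monic _).2, reflectionDegree]
  omega

/-- The shuffle of the even numbers below `2n` with the odd ones. -/
noncomputable def parityEquiv (n : ℕ) : Fin n ⊕ Fin n ≃ Fin (n + n) :=
  Equiv.ofBijective
    (fun c => ⟨reflectionDegree (c.map Fin.val Fin.val), by
      rcases c with i | i <;> simp only [Sum.map_inl, Sum.map_inr, reflectionDegree] <;> omega⟩)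
    ((Fintype.bijective_iff_injective_and_card _).mpr ⟨by
      rintro (i | i) (j | j) h <;>
        simp only [Sum.map_inl, Sum.map_inr, reflectionDegree, Fin.mk.injEq] at h <;>
        simp only [Sum.inl.injEq, Sum.inr.injEq, reduceCtorEq, Fin.ext_iff] <;> omega, by simp⟩)

theorem parityEquiv_val {n : ℕ} (c : Fin n ⊕ Fin n) :
    (parityEquiv n c : ℕ) = reflectionDegree (c.map Fin.val Fin.val) := rfl

theorem det_reflectionCoeff_parity (n : ℕ) :
    ((reflectionCoeff n).submatrix id (parityEquiv n).symm).det = 1 := by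
  have hd : ∀ r : Fin (n + n), (reflectionBasis (((parityEquiv n).symm r).map Fin.val
      Fin.val)).natDegree = r := by
    intro r
    rw [(reflectionBasis_monic _).2, ← parityEquiv_val, Equiv.apply_symm_apply]
  rw [Matrix.det_of_isUpperTriangular]
  · refine Finset.prod_eq_one fun r _ => ?_
    have := (reflectionBasis_monic (((parityEquiv n).symm r).map Fin.val Fin.val)).1.coeff_natDegree
    rw [hd r] at this
    exact this
  · intro r c hrc
    have h : (reflectionBasis (((parityEquiv n).symm c).map Fin.val Fin.val)).coeff (r : ℕ) = 0 :=
      coeff_eq_zero_of_natDegree_lt (by rw [hd c]; exact hrc)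
    exact h

theorem sum_reflectionDegree_inr (n : ℕ) : ∑ l : Fin n, (2 * (l : ℕ) + 1) = n * n := by
  rw [Fin.sum_univ_eq_sum_range (fun l => 2 * l + 1)]
  induction n with
  | zero => simp
  | succ k ih => rw [Finset.sum_range_succ, ih]; ring

/-- With its rows listed as a shuffle, the matrix of eigenvectors has determinant `±1`. -/
theorem det_reflectionCoeff_shuffle {n : ℕ} (e : Fin n ⊕ Fin n ≃ Fin (n + n))
    (hx : StrictMono (e ∘ Sum.inl)) (hy : StrictMono (e ∘ Sum.inr)) :
    ((reflectionCoeff n).submatrix e id).det =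
      (-1) ^ (n + ∑ l : Fin n, (e (Sum.inr l) : ℕ)) := by
  have hs1 := sign_shuffle e hx hy
  have hs2 := sign_shuffle (parityEquiv n)
    (by intro a b h; simp only [Function.comp_apply, Fin.lt_def, parityEquiv_val, Sum.map_inl,
          reflectionDegree] at h ⊢; omega)
    (by intro a b h; simp only [Function.comp_apply, Fin.lt_def, parityEquiv_val, Sum.map_inr,
          reflectionDegree] at h ⊢; omega)
  set M := (reflectionCoeff n).submatrix id (parityEquiv n).symm with hM
  have h1 : ((reflectionCoeff n).submatrix e id) = (((M.submatrix (finSumFinEquiv.symm.trans e) id)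
      |>.submatrix id (finSumFinEquiv.symm.trans (parityEquiv n))).submatrix
        finSumFinEquiv finSumFinEquiv) := by
    ext r c
    simp [hM]
  rw [h1, Matrix.det_submatrix_equiv_self, Matrix.det_permute', Matrix.det_permute,
    det_reflectionCoeff_parity, hs1, hs2]
  simp only [parityEquiv_val, Sum.map_inr, reflectionDegree, Units.val_pow_eq_pow_val,
    Units.val_neg, Units.val_one, Int.cast_pow, Int.cast_neg, Int.cast_one, mul_one, ← pow_add]
  rw [Finset.sum_add_distrib (f := fun l : Fin n => (l : ℕ) + n),
    Finset.sum_add_distrib (f := fun l : Fin n => (l : ℕ) + n), sum_reflectionDegree_inr]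
  apply neg_one_pow_congr
  have : Even (n * n + n) := by rw [← Nat.mul_succ]; exact Nat.even_mul_succ_self n
  rw [Nat.even_iff] at *
  rw [Nat.even_iff]
  omega

theorem det_fromBlocks_one_zero {n : ℕ} (M N : Matrix (Fin n) (Fin n) ℚ) :
    (fromBlocks M N (1 : Matrix (Fin n) (Fin n) ℚ) 0).det = (-1) ^ n * N.det := by
  have h : fromBlocks M N (1 : Matrix (Fin n) (Fin n) ℚ) 0 *
      fromBlocks 1 1 0 (1 : Matrix (Fin n) (Fin n) ℚ) = fromBlocks M (M + N) 1 1 := by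
    simp [fromBlocks_multiply]
  have h2 := congrArg Matrix.det h
  rw [det_mul, det_fromBlocks_zero₂₁, det_fromBlocks_one₂₂] at h2
  simp only [det_one, mul_one] at h2
  rw [h2]
  simp [Matrix.det_neg]

/-- A minor of the Pascal matrix whose rows and columns are complementary is `2^n` times a product
of minors of the matrix of eigenvectors: the product of `[[E₁₁ + 1, E₁₂], [1, 0]]` with the matrix
of eigenvectors is block triangular. -/
theorem det_choose_shuffle {n : ℕ} (e : Fin n ⊕ Fin n ≃ Fin (n + n))
    (hx : StrictMono (e ∘ Sum.inl)) (hy : StrictMono (e ∘ Sum.inr)) :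
    (Matrix.of fun k l : Fin n =>
      ((e (Sum.inr l) : ℕ).choose (e (Sum.inl k) : ℕ) : ℚ)).det =
    2 ^ n * (((reflectionCoeff n).submatrix (e ∘ Sum.inl) Sum.inl).det *
      ((reflectionCoeff n).submatrix (e ∘ Sum.inl) Sum.inr).det) := by
  set B := reflectionCoeff n with hB
  set P₁ := B.submatrix (e ∘ Sum.inl) Sum.inl
  set Q₁ := B.submatrix (e ∘ Sum.inl) Sum.inr
  set P₂ := B.submatrix (e ∘ Sum.inr) Sum.inl
  set Q₂ := B.submatrix (e ∘ Sum.inr) Sum.inr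
  set E := reflectionMatrix (n + n)
  set E₁₁ := E.submatrix (e ∘ Sum.inl) (e ∘ Sum.inl)
  set E₁₂ := E.submatrix (e ∘ Sum.inl) (e ∘ Sum.inr)
  have hBe : B.submatrix e id = fromBlocks P₁ Q₁ P₂ Q₂ := by
    ext (r | r) (c | c) <;> rfl
  have hP : E₁₁ * P₁ + E₁₂ * P₂ = P₁ := by
    ext k i
    have h := reflectionMatrix_mul_inl (e (Sum.inl k)) i
    rw [← Equiv.sum_comp e, Fintype.sum_sum_type] at h
    exact h
  have hQ : E₁₁ * Q₁ + E₁₂ * Q₂ = -Q₁ := by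
    ext k i
    have h := reflectionMatrix_mul_inr (e (Sum.inl k)) i
    rw [← Equiv.sum_comp e, Fintype.sum_sum_type] at h
    exact h
  have hprod : fromBlocks (E₁₁ + 1) E₁₂ 1 0 * B.submatrix e id =
      fromBlocks ((2 : ℚ) • P₁) 0 P₁ Q₁ := by
    rw [hBe, fromBlocks_multiply]
    congr 1
    · rw [Matrix.add_mul, add_right_comm, hP, one_mul, two_smul]
    · rw [Matrix.add_mul, add_right_comm, hQ, one_mul, neg_add_cancel]
    · simp
    · simp
  have hdet := congrArg Matrix.det hprod
  rw [det_mul, det_fromBlocks_one_zero, det_fromBlocks_zero₁₂, det_smul,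
    det_reflectionCoeff_shuffle e hx hy, Fintype.card_fin] at hdet
  have hE : E₁₂.det = (-1) ^ (∑ l : Fin n, (e (Sum.inr l) : ℕ)) *
      (Matrix.of fun k l : Fin n =>
        ((e (Sum.inr l) : ℕ).choose (e (Sum.inl k) : ℕ) : ℚ)).det := by
    rw [← Finset.prod_pow_eq_pow_sum]
    rw [← Matrix.det_mul_row (fun l : Fin n => (-1 : ℚ) ^ (e (Sum.inr l) : ℕ))]
    rfl
  rw [hE] at hdet
  rw [← mul_assoc, ← hdet, pow_add]
  set s := ∑ l : Fin n, (e (Sum.inr l) : ℕ)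
  have h1 : ((-1 : ℚ) ^ n) * (-1) ^ n = 1 := by rw [← mul_pow]; simp
  have h2 : ((-1 : ℚ) ^ s) * (-1) ^ s = 1 := by rw [← mul_pow]; simp
  generalize (Matrix.of fun k l : Fin n =>
    ((e (Sum.inr l) : ℕ).choose (e (Sum.inl k) : ℕ) : ℚ)).det = D
  linear_combination (-D) * h1 - D * ((-1) ^ n) * ((-1) ^ n) * h2

/-! ### The matrix `U(n)` -/

theorem coeff_reflectionBasis_inl (i r : ℕ) :
    (reflectionBasis (Sum.inl i)).coeff r = if i ≤ r then (i.choose (r - i) : ℚ) else 0 := by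
  simp only [reflectionBasis]
  rw [mul_pow, coeff_X_pow_mul', coeff_X_add_one_pow]

theorem coeff_reflectionBasis_inl_symm {j r : ℕ} (h : r ≤ 3 * j) :
    (reflectionBasis (Sum.inl j)).coeff r = (reflectionBasis (Sum.inl j)).coeff (3 * j - r) := by
  rw [coeff_reflectionBasis_inl, coeff_reflectionBasis_inl]
  by_cases h1 : j ≤ r
  · by_cases h2 : j ≤ 3 * j - r
    · rw [if_pos h1, if_pos h2, Nat.choose_symm_of_eq_add (by omega : j = r - j + (3 * j - r - j))]
    · rw [if_pos h1, if_neg h2, Nat.choose_eq_zero_of_lt (by omega), Nat.cast_zero]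
  · rw [if_neg h1]
    by_cases h2 : j ≤ 3 * j - r
    · rw [if_pos h2, Nat.choose_eq_zero_of_lt (by omega), Nat.cast_zero]
    · rw [if_neg h2]

theorem coeff_reflectionBasis_inl_eq_zero {j r : ℕ} (h : 2 * j < r) :
    (reflectionBasis (Sum.inl j)).coeff r = 0 := by
  refine coeff_eq_zero_of_natDegree_lt ?_
  rw [(reflectionBasis_monic _).2]
  exact h

/-- By the palindromicity of `(X(X+1))^j`, pairing its coefficients, moved by `d`, with those of
`(X(X+1))^i` yields a coefficient of the product. -/
theorem sum_coeff_mul_coeff (i j d N : ℕ) (hN : 2 * j + d < N) :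
    ∑ r ∈ range N, (reflectionBasis (Sum.inl i)).coeff r *
        (if d ≤ r then (reflectionBasis (Sum.inl j)).coeff (r - d) else 0) =
      (reflectionBasis (Sum.inl (i + j))).coeff (3 * j + d) := by
  have hz : ∀ r, r ∉ range (2 * j + d + 1) → (reflectionBasis (Sum.inl i)).coeff r *
      (if d ≤ r then (reflectionBasis (Sum.inl j)).coeff (r - d) else 0) = 0 := by
    intro r hr
    rw [Finset.mem_range] at hr
    rw [if_pos (by omega : d ≤ r), coeff_reflectionBasis_inl_eq_zero (by omega : 2 * j < r - d),
      mul_zero]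
  rw [← Finset.sum_subset (Finset.range_subset_range.mpr (by omega : 2 * j + d + 1 ≤ N))
    (fun r _ hr => hz r hr),
    Finset.sum_subset (Finset.range_subset_range.mpr (by omega : 2 * j + d + 1 ≤ 3 * j + d + 1))
    (fun r _ hr => hz r hr)]
  have hmul : reflectionBasis (Sum.inl (i + j)) =
      reflectionBasis (Sum.inl i) * reflectionBasis (Sum.inl j) := by
    simp only [reflectionBasis, pow_add]
  rw [hmul, coeff_mul, Finset.Nat.sum_antidiagonal_eq_sum_range_succ_mk]
  refine Finset.sum_congr rfl fun r hr => ?_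
  rw [Finset.mem_range] at hr
  congr 1
  by_cases h : d ≤ r
  · rw [if_pos h, coeff_reflectionBasis_inl_symm (by omega)]
    congr 1
    omega
  · rw [if_neg h, coeff_reflectionBasis_inl, if_pos (by omega), Nat.choose_eq_zero_of_lt (by omega),
      Nat.cast_zero]

theorem U_eq_mul (n : ℕ) :
    U n = ((reflectionCoeff n).submatrix id Sum.inl)ᵀ *
      (reflectionCoeff n).submatrix id Sum.inr := by
  ext i j
  have hq : ∀ r : ℕ, (reflectionBasis (Sum.inr (j : ℕ))).coeff r =
      (1 / 2 : ℚ) * (if 0 ≤ r then (reflectionBasis (Sum.inl (j : ℕ))).coeff (r - 0) else 0) +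
        (if 1 ≤ r then (reflectionBasis (Sum.inl (j : ℕ))).coeff (r - 1) else 0) := by
    intro r
    have : reflectionBasis (Sum.inr (j : ℕ)) = C (1 / 2) * reflectionBasis (Sum.inl (j : ℕ)) +
        X ^ 1 * reflectionBasis (Sum.inl (j : ℕ)) := by
      simp only [reflectionBasis]; ring
    rw [this, coeff_add, coeff_C_mul, coeff_X_pow_mul']
    simp
  simp only [Matrix.mul_apply, Matrix.transpose_apply, Matrix.submatrix_apply, id, reflectionCoeff,
    Matrix.of_apply, Sum.map_inl, Sum.map_inr]
  rw [Fin.sum_univ_eq_sum_range (fun r => (reflectionBasis (Sum.inl (i : ℕ))).coeff r *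
    (reflectionBasis (Sum.inr (j : ℕ))).coeff r)]
  simp_rw [hq, mul_add, mul_left_comm _ (1 / 2 : ℚ), Finset.sum_add_distrib, ← Finset.mul_sum]
  rw [sum_coeff_mul_coeff _ _ _ _ (by omega), sum_coeff_mul_coeff _ _ _ _ (by omega)]
  have key : ∀ d : ℕ, (reflectionBasis (Sum.inl ((i : ℕ) + j))).coeff (3 * j + d) =
      (binom ((i : ℕ) + (j : ℕ)) (2 * ((i : ℕ) : ℤ) - ((j : ℕ) : ℤ) - d) : ℚ) := by
    intro d
    rw [coeff_reflectionBasis_inl, binom]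
    split_ifs with h1 h2 h2
    · rw [Nat.choose_symm_of_eq_add]
      omega
    · rw [Nat.choose_eq_zero_of_lt (by omega)]
    · rw [Nat.choose_eq_zero_of_lt (by omega), Nat.cast_zero]
    · simp
  rw [key, key]
  simp [U]

/-- Both `2^n det U(n)` and the sum of the minors of the Pascal matrix with complementary rows and
columns are expanded over the `n`-element subsets of `{0, …, 2n-1}`. -/
theorem sum_det_choose (n : ℕ) (e : (Fin n ↪o Fin (n + n)) → (Fin n ⊕ Fin n ≃ Fin (n + n)))
    (hx : ∀ x, e x ∘ Sum.inl = x) (hy : ∀ x, StrictMono (e x ∘ Sum.inr)) :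
    ∑ x, (Matrix.of fun k l : Fin n =>
      ((e x (Sum.inr l) : ℕ).choose (x k : ℕ) : ℚ)).det = 2 ^ n * (U n).det := by
  rw [U_eq_mul, det_mul_eq_sum_minors, Finset.mul_sum]
  refine Finset.sum_congr rfl fun x _ => ?_
  have h := det_choose_shuffle (e x) (by rw [hx]; exact x.strictMono) (hy x)
  have hxk : ∀ k, e x (Sum.inl k) = x k := fun k => congrFun (hx x) k
  simp only [hx, hxk] at h
  rw [h]
  congr 2
  rw [← Matrix.det_transpose]
  rfl

end Reflection

/-! ### Nonintersecting lattice paths -/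

section Paths

variable {n m : ℕ}

/-- The step at time `c` of `n` nonintersecting particles, at the positions `x`: each particle stays
or moves up by one, except that the particles below `c` are frozen. -/
def Step (c : ℕ) (x y : Fin n ↪o Fin m) : Prop :=
  ∀ k, (y k : ℕ) = x k ∨ (c ≤ (x k : ℕ) ∧ (y k : ℕ) = x k + 1)

/-- The transfer matrix of a single particle at time `c`. -/
def stepMatrix (m c : ℕ) : Matrix (Fin m) (Fin m) ℚ :=
  Matrix.of fun x y => if (y : ℕ) = x ∨ (c ≤ (x : ℕ) ∧ (y : ℕ) = x + 1) then 1 else 0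

/-- The number of ways in which one particle goes from `x` at time `0` to `y` at time `c`. -/
def pathMatrix (m c : ℕ) : Matrix (Fin m) (Fin m) ℚ :=
  Matrix.of fun x y => if x ≤ y then ((min c y).choose (y - x) : ℚ) else 0

theorem pathMatrix_zero (m : ℕ) : pathMatrix m 0 = 1 := by
  ext x y
  simp only [pathMatrix, Matrix.of_apply, Matrix.one_apply, Nat.zero_min, Fin.le_def, Fin.ext_iff]
  split_ifs with h1 h2 h2
  · simp [h2]
  · rw [Nat.choose_eq_zero_of_lt (by omega), Nat.cast_zero]
  · omega
  · rfl

theorem pathMatrix_succ (m c : ℕ) : pathMatrix m (c + 1) = pathMatrix m c * stepMatrix m c := by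
  ext x y
  have h : ∀ z : Fin m, pathMatrix m c x z * stepMatrix m c z y =
      (if z = y then pathMatrix m c x y else 0) +
        (if c ≤ (z : ℕ) ∧ (y : ℕ) = z + 1 then pathMatrix m c x z else 0) := by
    intro z
    simp only [stepMatrix, Matrix.of_apply]
    by_cases hzy : z = y
    · subst hzy; simp
    · have : (y : ℕ) ≠ z := fun h => hzy (Fin.ext h.symm)
      simp [hzy, this]
  rw [Matrix.mul_apply]
  simp_rw [h]
  rw [Finset.sum_add_distrib, Finset.sum_ite_eq' univ y, if_pos (Finset.mem_univ _)]
  by_cases hy : c + 1 ≤ (y : ℕ)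
  · have hz : ∀ z : Fin m, (c ≤ (z : ℕ) ∧ (y : ℕ) = z + 1) ↔
        z = ⟨(y : ℕ) - 1, by omega⟩ := by
      intro z
      rw [Fin.ext_iff]
      simp only
      omega
    simp_rw [hz]
    rw [Finset.sum_ite_eq' univ, if_pos (Finset.mem_univ _)]
    simp only [pathMatrix, Matrix.of_apply, Fin.le_def]
    rw [min_eq_left hy, min_eq_left (by omega : c ≤ (y : ℕ)),
      min_eq_left (by omega : c ≤ (y : ℕ) - 1)]
    by_cases h1 : (x : ℕ) ≤ y
    · by_cases h2 : (x : ℕ) ≤ (y : ℕ) - 1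
      · rw [if_pos h1, if_pos h1, if_pos h2]
        obtain ⟨d, hd⟩ : ∃ d, (y : ℕ) - x = d + 1 := ⟨(y : ℕ) - x - 1, by omega⟩
        rw [hd, show (y : ℕ) - 1 - x = d by omega, Nat.choose_succ_succ]
        push_cast
        ring
      · rw [if_pos h1, if_pos h1, if_neg h2, show (y : ℕ) - x = 0 by omega]
        simp
    · rw [if_neg h1, if_neg h1, if_neg (by omega), add_zero]
  · rw [Finset.sum_eq_zero fun z _ => if_neg (by omega), add_zero]
    simp only [pathMatrix, Matrix.of_apply]
    rw [min_eq_right (by omega), min_eq_right (by omega)]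

/-- The minors of the transfer matrix: an inversion of `σ` would need two particles to swap their
order in one step, so only the identity contributes. -/
theorem det_stepMatrix (c : ℕ) (x y : Fin n ↪o Fin m) [Decidable (Step c x y)] :
    ((stepMatrix m c).submatrix x y).det = if Step c x y then 1 else 0 := by
  classical
  rw [Matrix.det_apply', Finset.sum_eq_single_of_mem 1 (Finset.mem_univ _)]
  · simp only [stepMatrix, Matrix.submatrix_apply, Matrix.of_apply, Equiv.Perm.sign_one,
      Units.val_one, Int.cast_one, one_mul, Equiv.Perm.one_apply, Finset.prod_ite_zero,
      Finset.prod_const_one, Finset.mem_univ, true_imp_iff]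
    exact if_congr Iff.rfl rfl rfl
  · intro σ _ hσ
    rw [mul_eq_zero]
    right
    by_contra hne
    apply hσ
    have hk : ∀ k, (x (σ k) : ℕ) ≤ y k ∧ (y k : ℕ) ≤ x (σ k) + 1 := by
      intro k
      have h := Finset.prod_ne_zero_iff.mp hne k (Finset.mem_univ _)
      simp only [stepMatrix, Matrix.submatrix_apply, Matrix.of_apply, ne_eq, ite_eq_right_iff,
        one_ne_zero, imp_false, not_not] at h
      omega
    have hmono : StrictMono σ := by
      intro a b hab
      by_contra hlt
      have h1 : σ b < σ a := lt_of_le_of_ne (not_lt.mp hlt) fun h => hab.ne' (σ.injective h)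
      have h2 : (x (σ b) : ℕ) < x (σ a) := x.strictMono h1
      have h3 : (y a : ℕ) < y b := y.strictMono hab
      have h4 := hk a
      have h5 := hk b
      omega
    ext k
    have := (StrictMono.range_inj hmono strictMono_id).mp (by simp)
    rw [this]
    rfl

/-- The **Lindström–Gessel–Viennot lemma** for this system of paths. -/
theorem card_paths (c : ℕ) (x y : Fin n ↪o Fin m)
    [DecidablePred fun s : Fin (c + 1) → (Fin n ↪o Fin m) => s 0 = x ∧ s (Fin.last c) = y ∧
      ∀ i : Fin c, Step i (s i.castSucc) (s i.succ)] :
    ((univ.filter fun s : Fin (c + 1) → (Fin n ↪o Fin m) => s 0 = x ∧ s (Fin.last c) = y ∧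
      ∀ i : Fin c, Step i (s i.castSucc) (s i.succ)).card : ℚ) =
    ((pathMatrix m c).submatrix x y).det := by
  classical
  induction c generalizing y with
  | zero =>
    rw [pathMatrix_zero]
    -- At the time `m` all the particles are frozen.
    have h1 : ((1 : Matrix (Fin m) (Fin m) ℚ).submatrix x y) = (stepMatrix m m).submatrix x y := by
      ext k l
      have := (x k).2
      simp only [Matrix.submatrix_apply, Matrix.one_apply, stepMatrix, Matrix.of_apply, Fin.ext_iff]
      congr 1
      rw [eq_iff_iff]
      omega
    rw [h1, det_stepMatrix]
    have h2 : Step m x y ↔ x = y := by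
      constructor
      · intro h
        ext k
        have := h k
        have := (x k).2
        omega
      · rintro rfl k
        exact Or.inl rfl
    simp only [h2, Fin.last_zero, IsEmpty.forall_iff, and_true]
    by_cases hxy : x = y
    · rw [if_pos hxy]
      have : (univ.filter fun s : Fin (0 + 1) → (Fin n ↪o Fin m) => s 0 = x ∧ s 0 = y) =
          {fun _ => x} := by
        ext s
        simp only [Finset.mem_filter, Finset.mem_univ, true_and, Finset.mem_singleton]
        constructor
        · rintro ⟨h, _⟩
          funext i
          exact (congrArg s (Subsingleton.elim (α := Fin 1) i 0)).trans h
        · rintro rfl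
          exact ⟨rfl, hxy⟩
      rw [this]
      simp
    · rw [if_neg hxy]
      have : (univ.filter fun s : Fin (0 + 1) → (Fin n ↪o Fin m) => s 0 = x ∧ s 0 = y) = ∅ := by
        ext s
        simp only [Finset.mem_filter, Finset.mem_univ, true_and, Finset.notMem_empty, iff_false]
        rintro ⟨h1, h2⟩
        exact hxy (h1.symm.trans h2)
      rw [this]
      simp
  | succ c ih =>
    rw [pathMatrix_succ]
    have h1 : (pathMatrix m c * stepMatrix m c).submatrix x y =
        (pathMatrix m c).submatrix x id * (stepMatrix m c).submatrix id y := by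
      ext k l; rfl
    rw [h1, det_mul_eq_sum_minors]
    simp only [Matrix.submatrix_submatrix, Function.comp_id, Function.id_comp]
    have h2 : (univ.filter fun s : Fin (c + 1 + 1) → (Fin n ↪o Fin m) =>
        s 0 = x ∧ s (Fin.last (c + 1)) = y ∧
          ∀ i : Fin (c + 1), Step i (s i.castSucc) (s i.succ)).card =
        (univ.filter fun s : Fin (c + 1) → (Fin n ↪o Fin m) => Step c (s (Fin.last c)) y ∧
          s 0 = x ∧ ∀ i : Fin c, Step i (s i.castSucc) (s i.succ)).card := by
      refine Finset.card_nbij' (fun s i => s i.castSucc)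
        (fun s => Fin.snoc (α := fun _ => Fin n ↪o Fin m) s y) ?_ ?_ ?_ ?_
      · intro s hs
        simp only [Finset.coe_filter, Finset.mem_univ, true_and, Set.mem_ofPred_eq] at hs ⊢
        refine ⟨?_, hs.1, fun i => ?_⟩
        · have := hs.2.2 (Fin.last c)
          rw [Fin.succ_last, hs.2.1] at this
          exact this
        · have := hs.2.2 i.castSucc
          exact this
      · intro s hs
        simp only [Finset.coe_filter, Finset.mem_univ, true_and, Set.mem_ofPred_eq] at hs ⊢
        refine ⟨?_, by simp, fun i => ?_⟩
        · rw [← Fin.castSucc_zero, Fin.snoc_castSucc]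
          exact hs.2.1
        · refine Fin.lastCases ?_ (fun i => ?_) i
          · rw [Fin.snoc_castSucc, Fin.succ_last, Fin.snoc_last]
            exact hs.1
          · rw [Fin.snoc_castSucc, ← Fin.castSucc_succ, Fin.snoc_castSucc]
            exact hs.2.2 i
      · intro s hs
        simp only [Finset.coe_filter, Finset.mem_univ, true_and, Set.mem_ofPred_eq] at hs
        funext i
        refine Fin.lastCases ?_ (fun i => ?_) i
        · simp [hs.2.1]
        · simp
      · intro s hs
        funext i
        simp
    rw [h2, Finset.card_eq_sum_card_fiberwise (f := fun s => s (Fin.last c)) (t := univ)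
      (by simp), Nat.cast_sum]
    refine Finset.sum_congr rfl fun z _ => ?_
    rw [det_stepMatrix, ← ih z, Finset.filter_filter]
    by_cases hz : Step c z y
    · rw [if_pos hz, mul_one]
      congr 2
      ext s
      simp only [Finset.mem_filter, Finset.mem_univ, true_and]
      constructor
      · rintro ⟨⟨h1, h2, h3⟩, h4⟩
        exact ⟨h2, h4, h3⟩
      · rintro ⟨h2, h4, h3⟩
        exact ⟨⟨h4 ▸ hz, h2, h3⟩, h4⟩
    · rw [if_neg hz, mul_zero, Nat.cast_eq_zero, Finset.card_eq_zero]
      ext s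
      simp only [Finset.mem_filter, Finset.mem_univ, true_and, Finset.notMem_empty, iff_false]
      rintro ⟨⟨h1, h2, h3⟩, h4⟩
      exact hz (h4 ▸ h1)

/-- The `n`-element subset of `Fin (n + n)` complementary to the range of `x`. -/
noncomputable def complEmb (x : Fin n ↪o Fin (n + n)) : Fin n ↪o Fin (n + n) :=
  (univ.map x.toEmbedding)ᶜ.orderEmbOfFin (by simp [Finset.card_compl])

theorem range_complEmb (x : Fin n ↪o Fin (n + n)) :
    Set.range (complEmb x) = (Set.range x)ᶜ := by
  rw [complEmb, Finset.range_orderEmbOfFin]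
  ext a
  simp

/-- The shuffle that lists the range of `x` and then its complement. -/
noncomputable def complEquiv (x : Fin n ↪o Fin (n + n)) : Fin n ⊕ Fin n ≃ Fin (n + n) :=
  Equiv.ofBijective (Sum.elim x (complEmb x))
    ((Fintype.bijective_iff_injective_and_card _).mpr
      ⟨x.injective.sumElim (complEmb x).injective fun a b h => by
        have : complEmb x b ∈ (Set.range x)ᶜ := range_complEmb x ▸ Set.mem_range_self b
        exact this ⟨a, h⟩, by simp⟩)

/-- A system of nonintersecting paths that goes on until all the particles are frozen, and ends on
the positions that were free at the start. -/
def IsSector (s : Fin (n + n + 1) → (Fin n ↪o Fin (n + n))) : Prop :=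
  (∀ i : Fin (n + n), Step i (s i.castSucc) (s i.succ)) ∧
    Set.range (s (Fin.last (n + n))) = (Set.range (s 0))ᶜ

theorem card_isSector (n : ℕ) [DecidablePred (IsSector (n := n))] :
    ((univ.filter (IsSector (n := n))).card : ℚ) = 2 ^ n * (U n).det := by
  classical
  rw [← sum_det_choose n complEquiv (fun x => rfl) (fun x => (complEmb x).strictMono),
    Finset.card_eq_sum_card_fiberwise (f := fun s => s 0) (t := univ) (by simp), Nat.cast_sum]
  refine Finset.sum_congr rfl fun x _ => ?_
  have h1 : ((univ.filter (IsSector (n := n))).filter fun s => s 0 = x) =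
      univ.filter fun s : Fin (n + n + 1) → (Fin n ↪o Fin (n + n)) => s 0 = x ∧
        s (Fin.last (n + n)) = complEmb x ∧
          ∀ i : Fin (n + n), Step i (s i.castSucc) (s i.succ) := by
    ext s
    simp only [Finset.mem_filter, Finset.mem_univ, true_and, IsSector]
    constructor
    · rintro ⟨⟨h1, h2⟩, h3⟩
      refine ⟨h3, ?_, h1⟩
      rw [← OrderEmbedding.range_inj, range_complEmb, h2, h3]
    · rintro ⟨h3, h2, h1⟩
      refine ⟨⟨h1, ?_⟩, h3⟩
      rw [h2, range_complEmb, h3]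
  rw [h1, card_paths]
  congr 1
  ext k l
  simp only [Matrix.submatrix_apply, pathMatrix, Matrix.of_apply, Fin.le_def]
  change _ = (((complEmb x l : Fin (n + n)) : ℕ).choose (x k : ℕ) : ℚ)
  have := (complEmb x l).2
  rw [min_eq_right this.le]
  split_ifs with h
  · rw [Nat.choose_symm h]
  · rw [Nat.choose_eq_zero_of_lt (by omega), Nat.cast_zero]

end Paths

/-! ### Counting functions of particle configurations -/

section Counting

variable {n m : ℕ}

/-- The number of particles of the configuration `x` at positions `≥ a`. -/
def countGE (x : Fin n ↪o Fin m) (a : ℕ) : ℕ :=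
  (univ.filter fun k => a ≤ (x k : ℕ)).card

theorem le_apply_iff_countGE (x : Fin n ↪o Fin m) (a : ℕ) (k : Fin n) :
    a ≤ (x k : ℕ) ↔ n ≤ countGE x a + k := by
  have hk := k.2
  constructor
  · intro h
    have h1 : Finset.Ici k ⊆ univ.filter fun k => a ≤ (x k : ℕ) := by
      intro l hl
      rw [Finset.mem_Ici] at hl
      have : x k ≤ x l := x.monotone hl
      simp only [Finset.mem_filter, Finset.mem_univ, true_and]
      exact h.trans this
    have := Finset.card_le_card h1
    rw [Fin.card_Ici] at this
    simp only [countGE]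
    omega
  · intro h
    by_contra hlt
    have h1 : (univ.filter fun k => a ≤ (x k : ℕ)) ⊆ Finset.Ioi k := by
      intro l hl
      simp only [Finset.mem_filter, Finset.mem_univ, true_and] at hl
      rw [Finset.mem_Ioi]
      by_contra hlk
      have : x l ≤ x k := x.monotone (not_lt.mp hlk)
      exact hlt (hl.trans this)
    have := Finset.card_le_card h1
    rw [Fin.card_Ioi] at this
    simp only [countGE] at h
    omega

theorem countGE_injective {x y : Fin n ↪o Fin m} (h : ∀ a, countGE x a = countGE y a) : x = y := by
  ext k
  have h1 := (le_apply_iff_countGE x (y k) k).mpr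
    (by rw [h]; exact (le_apply_iff_countGE y (y k) k).mp le_rfl)
  have h2 := (le_apply_iff_countGE y (x k) k).mpr
    (by rw [← h]; exact (le_apply_iff_countGE x (x k) k).mp le_rfl)
  exact le_antisymm h2 h1

theorem countGE_eq_zero (x : Fin n ↪o Fin m) {a : ℕ} (ha : m ≤ a) : countGE x a = 0 := by
  rw [countGE, Finset.card_eq_zero, Finset.filter_eq_empty_iff]
  intro k _
  have := (x k).2
  omega

open Classical in
theorem countGE_eq_succ_add (x : Fin n ↪o Fin m) (a : ℕ) :
    countGE x a = countGE x (a + 1) + if ∃ k, (x k : ℕ) = a then 1 else 0 := by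
  have h : (univ.filter fun k => a ≤ (x k : ℕ)) =
      (univ.filter fun k => a + 1 ≤ (x k : ℕ)) ∪ univ.filter fun k => (x k : ℕ) = a := by
    ext k
    simp only [Finset.mem_filter, Finset.mem_univ, true_and, Finset.mem_union]
    omega
  rw [countGE, h, Finset.card_union_of_disjoint, countGE]
  · congr 1
    split_ifs with hk
    · obtain ⟨k, hk⟩ := hk
      rw [Finset.card_eq_one]
      refine ⟨k, ?_⟩
      ext l
      simp only [Finset.mem_filter, Finset.mem_univ, true_and, Finset.mem_singleton]
      constructor
      · intro hl
        exact x.injective (Fin.ext (hl.trans hk.symm))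
      · rintro rfl
        exact hk
    · rw [Finset.card_eq_zero, Finset.filter_eq_empty_iff]
      intro k _ h
      exact hk ⟨k, h⟩
  · rw [Finset.disjoint_filter]
    intro k _ h1 h2
    omega

theorem countGE_succ_le (x : Fin n ↪o Fin m) (a : ℕ) : countGE x (a + 1) ≤ countGE x a := by
  rw [countGE_eq_succ_add x a]; omega

theorem countGE_le_succ (x : Fin n ↪o Fin m) (a : ℕ) : countGE x a ≤ countGE x (a + 1) + 1 := by
  rw [countGE_eq_succ_add x a]; split_ifs <;> omega

theorem mem_range_iff_countGE (x : Fin n ↪o Fin m) (i : Fin m) :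
    i ∈ Set.range x ↔ countGE x (i + 1) < countGE x i := by
  rw [countGE_eq_succ_add x i]
  have : i ∈ Set.range x ↔ ∃ k, (x k : ℕ) = i := by
    simp only [Set.mem_range, Fin.ext_iff]
  rw [this]
  split_ifs with h <;> simp [h]

/-- A step in terms of counting functions. -/
theorem step_iff_countGE {c : ℕ} {x y : Fin n ↪o Fin m} :
    Step c x y ↔ (∀ a, countGE x a ≤ countGE y a) ∧ (∀ a, countGE y (a + 1) ≤ countGE x a) ∧
      ∀ a ≤ c, countGE y a = countGE x a := by
  constructor
  · intro h
    refine ⟨fun a => ?_, fun a => ?_, fun a ha => ?_⟩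
    · refine Finset.card_le_card fun k hk => ?_
      simp only [Finset.mem_filter, Finset.mem_univ, true_and] at hk ⊢
      have := h k
      omega
    · refine Finset.card_le_card fun k hk => ?_
      simp only [Finset.mem_filter, Finset.mem_univ, true_and] at hk ⊢
      have := h k
      omega
    · unfold countGE
      congr 1
      ext k
      simp only [Finset.mem_filter, Finset.mem_univ, true_and]
      have := h k
      omega
  · rintro ⟨h1, h2, h3⟩ k
    have hle : (x k : ℕ) ≤ y k := by
      rw [le_apply_iff_countGE]
      have := (le_apply_iff_countGE x (x k) k).mp le_rfl
      have := h1 (x k)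
      omega
    have hle2 : (y k : ℕ) ≤ x k + 1 := by
      by_contra hlt
      have h4 := (le_apply_iff_countGE y (x k + 1 + 1) k).mp (by omega)
      have h5 := h2 (x k + 1)
      have h6 := (le_apply_iff_countGE x (x k + 1) k).mpr (by omega)
      omega
    by_contra hne
    have h4 := (le_apply_iff_countGE y (x k + 1) k).mp (by omega)
    rw [h3 _ (by omega), ← le_apply_iff_countGE] at h4
    omega

/-- Two configurations are complementary if and only if their counting functions add up to that of
all the positions. -/
theorem range_eq_compl_iff_countGE (x y : Fin n ↪o Fin m) :
    Set.range y = (Set.range x)ᶜ ↔ ∀ a, countGE x a + countGE y a = m - a := by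
  constructor
  · intro h
    have key : ∀ d a, a + d = m → countGE x a + countGE y a = m - a := by
      intro d
      induction d with
      | zero =>
        intro a ha
        rw [countGE_eq_zero x (by omega), countGE_eq_zero y (by omega)]
        omega
      | succ d ih =>
        intro a ha
        have h1 := ih (a + 1) (by omega)
        have h2 : (⟨a, by omega⟩ : Fin m) ∈ Set.range y ↔ _ := Set.ext_iff.mp h ⟨a, by omega⟩
        rw [Set.mem_compl_iff, mem_range_iff_countGE, mem_range_iff_countGE] at h2
        simp only at h2
        have h3 := countGE_succ_le x a
        have h4 := countGE_le_succ x a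
        have h5 := countGE_succ_le y a
        have h6 := countGE_le_succ y a
        omega
    intro a
    by_cases ha : a ≤ m
    · exact key (m - a) a (by omega)
    · rw [countGE_eq_zero x (by omega), countGE_eq_zero y (by omega)]
      omega
  · intro h
    ext i
    rw [Set.mem_compl_iff, mem_range_iff_countGE, mem_range_iff_countGE]
    have hi := i.2
    have h1 := h i
    have h2 := h (i + 1)
    have h3 := countGE_succ_le x i
    have h4 := countGE_le_succ x i
    have h5 := countGE_succ_le y i
    have h6 := countGE_le_succ y i
    omega

/-- The functions that descend to `0` by steps `0` and `1` are counting functions. -/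
theorem exists_countGE_eq (h : ℕ → ℕ) (h0 : h 0 = n) (hm : ∀ a, m ≤ a → h a = 0)
    (hanti : ∀ a, h (a + 1) ≤ h a) (hdrop : ∀ a, h a ≤ h (a + 1) + 1) :
    ∃ x : Fin n ↪o Fin m, ∀ a, countGE x a = h a := by
  classical
  have hcard : ∀ d a, a + d = m →
      (univ.filter fun i : Fin m => h (i + 1) < h i ∧ a ≤ i).card = h a := by
    intro d
    induction d with
    | zero =>
      intro a ha
      rw [hm a (by omega), Finset.card_eq_zero, Finset.filter_eq_empty_iff]
      intro i _
      omega
    | succ d ih =>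
      intro a ha
      have h1 := ih (a + 1) (by omega)
      have h2 := hanti a
      have h3 := hdrop a
      by_cases hlt : h (a + 1) < h a
      · have hs : (univ.filter fun i : Fin m => h (i + 1) < h i ∧ a ≤ i) =
            insert ⟨a, by omega⟩ (univ.filter fun i : Fin m => h (i + 1) < h i ∧ a + 1 ≤ i) := by
          ext i
          simp only [Finset.mem_filter, Finset.mem_univ, true_and, Finset.mem_insert, Fin.ext_iff]
          constructor
          · rintro ⟨h4, h5⟩
            by_cases hi : (i : ℕ) = a
            · exact Or.inl hi
            · exact Or.inr ⟨h4, by omega⟩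
          · rintro (h4 | ⟨h4, h5⟩)
            · rw [h4]; exact ⟨hlt, le_rfl⟩
            · exact ⟨h4, by omega⟩
        rw [hs, Finset.card_insert_of_notMem (by simp), h1]
        omega
      · have hs : (univ.filter fun i : Fin m => h (i + 1) < h i ∧ a ≤ i) =
            (univ.filter fun i : Fin m => h (i + 1) < h i ∧ a + 1 ≤ i) := by
          ext i
          simp only [Finset.mem_filter, Finset.mem_univ, true_and]
          refine and_congr_right fun h4 => ?_
          have : (i : ℕ) ≠ a := by
            intro hi
            rw [hi] at h4
            exact hlt h4
          omega
        rw [hs, h1]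
        omega
  have hZ : (univ.filter fun i : Fin m => h (i + 1) < h i).card = n := by
    rw [← h0, ← hcard m 0 (by omega)]
    simp
  set Z := univ.filter fun i : Fin m => h (i + 1) < h i with hZdef
  refine ⟨Z.orderEmbOfFin hZ, fun a => ?_⟩
  have hc : countGE (Z.orderEmbOfFin hZ) a =
      (univ.filter fun i : Fin m => h (i + 1) < h i ∧ a ≤ i).card := by
    rw [countGE, ← Finset.card_map (Z.orderEmbOfFin hZ).toEmbedding]
    congr 1
    ext i
    have hi : (∃ k, Z.orderEmbOfFin hZ k = i) ↔ h (i + 1) < h i := by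
      have := Set.ext_iff.mp (Finset.range_orderEmbOfFin Z hZ) i
      rw [Set.mem_range, Finset.mem_coe] at this
      rw [this, hZdef, Finset.mem_filter]
      simp
    simp only [Finset.mem_map, Finset.mem_filter, Finset.mem_univ, true_and, ← hi,
      RelEmbedding.coe_toEmbedding]
    constructor
    · rintro ⟨k, h1, h2⟩
      exact ⟨⟨k, h2⟩, h2 ▸ h1⟩
    · rintro ⟨⟨k, h2⟩, h1⟩
      exact ⟨k, h2 ▸ h1, h2⟩
  rw [hc]
  by_cases ha : a ≤ m
  · exact hcard (m - a) a (by omega)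
  · rw [hm a (by omega), Finset.card_eq_zero, Finset.filter_eq_empty_iff]
    intro i _
    omega

end Counting

/-! ### Height functions on a sector -/

/-- The conditions on the array `F c a` of the numbers of particles at positions `≥ a` at time `c`
that hold for the path systems `IsSector`, the array being continued constantly in `c`. -/
structure IsHeight (m : ℕ) (F : ℕ → ℕ → ℕ) : Prop where
  anti : ∀ c a, F c (a + 1) ≤ F c a
  /-- Distinct particles are at distinct positions. -/
  drop : ∀ c a, F c a ≤ F c (a + 1) + 1
  /-- No particle moves down. -/
  mono : ∀ c a, F c a ≤ F (c + 1) a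
  /-- No particle moves up by more than one. -/
  diag : ∀ c a, F (c + 1) (a + 1) ≤ F c a
  /-- Particles below `c` stay from time `c` on. -/
  frozen : ∀ c a, a ≤ c → F (c + 1) a = F c a
  /-- The final positions, which below `a` are reached at time `a`, are complementary to the initial
  ones. -/
  comp : ∀ a, F 0 a + F a a = m - a

/-- The number of points of the plane partition on the line `(u, v, 0) + ℕ(1, 1, 1)`. The lines with
`v ≤ u` form the sector; those with `u < v` are brought there by the complementation. -/
def lineCount (m : ℕ) (F : ℕ → ℕ → ℕ) (u v : ℕ) : ℕ :=
  if v ≤ u then m - u - F v u else F (v - u) v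

/-- Membership of `(i, j, k)` in the plane partition of the array `F`. The line through the point
in the direction `(1, 1, 1)` is brought to the form `(u, v, 0) + ℕ(1, 1, 1)` by a cyclic permutation
of the coordinates. -/
def HeightMem (m : ℕ) (F : ℕ → ℕ → ℕ) (i j k : ℕ) : Prop :=
  if k ≤ i ∧ k ≤ j then k < lineCount m F (i - k) (j - k)
  else if i ≤ j ∧ i ≤ k then i < lineCount m F (j - i) (k - i)
  else j < lineCount m F (k - j) (i - j)

theorem heightMem_iff_of_third_le {m : ℕ} {F : ℕ → ℕ → ℕ} {i j k : ℕ} (hi : k ≤ i) (hj : k ≤ j) :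
    HeightMem m F i j k ↔ k < lineCount m F (i - k) (j - k) := by
  rw [HeightMem, if_pos ⟨hi, hj⟩]

/-- A property of points that is invariant under cyclic permutations of the coordinates may be
checked where the last coordinate is the smallest one. -/
theorem rotation_induction {P : ℕ → ℕ → ℕ → Prop} (hrot : ∀ i j k, P i j k → P k i j)
    (hmin : ∀ i j k, k ≤ i → k ≤ j → P i j k) (i j k : ℕ) : P i j k := by
  by_cases h1 : k ≤ i ∧ k ≤ j
  · exact hmin i j k h1.1 h1.2
  · by_cases h2 : i ≤ j ∧ i ≤ k
    · exact hrot _ _ _ (hmin _ _ _ h2.1 h2.2)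
    · exact hrot _ _ _ (hrot _ _ _ (hmin _ _ _ (by omega) (by omega)))

namespace IsHeight

variable {m : ℕ} {F : ℕ → ℕ → ℕ}

theorem eq_diag (h : IsHeight m F) (a d : ℕ) : F (a + d) a = F a a := by
  induction d with
  | zero => rfl
  | succ d ih => rw [← Nat.add_assoc, h.frozen _ _ (by omega), ih]

theorem le_diag (h : IsHeight m F) {c a : ℕ} (hc : c ≤ a) : F c a ≤ F a a := by
  obtain ⟨d, rfl⟩ := Nat.exists_eq_add_of_le hc
  have : ∀ e, F c (c + d) ≤ F (c + e) (c + d) := by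
    intro e
    induction e with
    | zero => rfl
    | succ e ih => exact ih.trans (h.mono _ _)
  exact this d

theorem le_sub (h : IsHeight m F) (c a : ℕ) : F c a ≤ m - a := by
  have hc := h.comp a
  rcases le_total c a with hca | hca
  · have := h.le_diag hca
    omega
  · obtain ⟨d, rfl⟩ := Nat.exists_eq_add_of_le hca
    rw [h.eq_diag]
    omega

theorem lineCount_zero_left (h : IsHeight m F) (v : ℕ) :
    lineCount m F 0 v = lineCount m F v 0 := by
  have hc := h.comp v
  unfold lineCount
  rw [if_pos (Nat.zero_le v)]
  split_ifs with hv
  · obtain rfl : v = 0 := by omega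
    rfl
  · rw [Nat.sub_zero]
    omega

theorem lineCount_succ_left (h : IsHeight m F) (u v : ℕ) :
    lineCount m F (u + 1) v ≤ lineCount m F u v := by
  unfold lineCount
  rcases lt_trichotomy v (u + 1) with hv | hv | hv
  · rw [if_pos (by omega), if_pos (by omega)]
    have := h.drop v u
    omega
  · subst hv
    rw [if_pos le_rfl, if_neg (by omega), show u + 1 - u = 0 + 1 by omega]
    have := h.comp (u + 1)
    have := h.mono 0 (u + 1)
    omega
  · rw [if_neg (by omega), if_neg (by omega)]
    have := h.mono (v - (u + 1)) v
    rwa [show v - (u + 1) + 1 = v - u by omega] at this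

theorem lineCount_succ_right (h : IsHeight m F) (u v : ℕ) :
    lineCount m F u (v + 1) ≤ lineCount m F u v := by
  unfold lineCount
  rcases lt_trichotomy v u with hv | hv | hv
  · rw [if_pos (by omega), if_pos (by omega)]
    have := h.mono v u
    omega
  · subst hv
    rw [if_pos le_rfl, if_neg (by omega), show v + 1 - v = 0 + 1 by omega]
    have := h.comp v
    have := h.diag 0 v
    omega
  · rw [if_neg (by omega), if_neg (by omega)]
    have := h.diag (v - u) v
    rwa [show v - u + 1 = v + 1 - u by omega] at this

theorem lineCount_le_succ_succ (h : IsHeight m F) (u v : ℕ) :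
    lineCount m F u v ≤ lineCount m F (u + 1) (v + 1) + 1 := by
  unfold lineCount
  by_cases hv : v ≤ u
  · rw [if_pos hv, if_pos (by omega)]
    have := h.diag v u
    have := h.le_sub (v + 1) (u + 1)
    omega
  · rw [if_neg hv, if_neg (by omega), show v + 1 - (u + 1) = v - u by omega]
    exact h.drop _ _

theorem mem_iff_of_first_le (h : IsHeight m F) {i j k : ℕ} (hj : i ≤ j) (hk : i ≤ k) :
    HeightMem m F i j k ↔ i < lineCount m F (j - i) (k - i) := by
  rw [HeightMem]
  split_ifs with h1 h2
  · obtain rfl : i = k := by omega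
    rw [Nat.sub_self, h.lineCount_zero_left]
  · rfl
  · exact absurd ⟨hj, hk⟩ h2

theorem mem_iff_of_second_le (h : IsHeight m F) {i j k : ℕ} (hi : j ≤ i) (hk : j ≤ k) :
    HeightMem m F i j k ↔ j < lineCount m F (k - j) (i - j) := by
  rw [HeightMem]
  split_ifs with h1 h2
  · obtain rfl : j = k := by omega
    rw [Nat.sub_self, h.lineCount_zero_left]
  · obtain rfl : i = j := by omega
    rw [Nat.sub_self, h.lineCount_zero_left]
  · rfl

theorem mem_rotate (h : IsHeight m F) (i j k : ℕ) :
    HeightMem m F i j k ↔ HeightMem m F k i j := by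
  by_cases h1 : k ≤ i ∧ k ≤ j
  · rw [heightMem_iff_of_third_le h1.1 h1.2, h.mem_iff_of_first_le h1.1 h1.2]
  · by_cases h2 : i ≤ j ∧ i ≤ k
    · rw [h.mem_iff_of_first_le h2.1 h2.2, h.mem_iff_of_second_le h2.2 h2.1]
    · rw [h.mem_iff_of_second_le (by omega) (by omega),
        heightMem_iff_of_third_le (by omega) (by omega)]

theorem mem_of_mem_succ (h : IsHeight m F) (i j k : ℕ) :
    (HeightMem m F (i + 1) j k → HeightMem m F i j k) ∧
    (HeightMem m F i (j + 1) k → HeightMem m F i j k) ∧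
    (HeightMem m F i j (k + 1) → HeightMem m F i j k) := by
  refine rotation_induction (P := fun i j k => (HeightMem m F (i + 1) j k → HeightMem m F i j k) ∧
    (HeightMem m F i (j + 1) k → HeightMem m F i j k) ∧
    (HeightMem m F i j (k + 1) → HeightMem m F i j k)) ?_ ?_ i j k
  · rintro i j k ⟨h1, h2, h3⟩
    rw [h.mem_rotate i j k] at h1 h2 h3
    rw [h.mem_rotate (i + 1)] at h1
    rw [h.mem_rotate i (j + 1)] at h2
    rw [h.mem_rotate i j (k + 1)] at h3
    exact ⟨h3, h1, h2⟩
  · intro i j k hi hj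
    obtain ⟨u, rfl⟩ := Nat.exists_eq_add_of_le hi
    obtain ⟨v, rfl⟩ := Nat.exists_eq_add_of_le hj
    have hl := h.lineCount_succ_left
    have hr := h.lineCount_succ_right
    refine ⟨?_, ?_, ?_⟩
    · rw [heightMem_iff_of_third_le (by omega) hj, heightMem_iff_of_third_le hi hj,
        show k + u + 1 - k = u + 1 by omega, show k + u - k = u by omega]
      intro h1
      exact h1.trans_le (hl _ _)
    · rw [heightMem_iff_of_third_le hi (by omega), heightMem_iff_of_third_le hi hj,
        show k + v + 1 - k = v + 1 by omega, show k + v - k = v by omega]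
      intro h1
      exact h1.trans_le (hr _ _)
    · rcases Nat.eq_zero_or_pos u with rfl | hu
      · rw [h.mem_iff_of_first_le (by omega) (by omega),
          h.mem_iff_of_first_le (by omega) (by omega),
          show k + 0 = k from rfl, show k + 1 - k = 0 + 1 by omega, show k - k = 0 by omega]
        intro h1
        exact h1.trans_le (hr _ _)
      · rcases Nat.eq_zero_or_pos v with rfl | hv
        · rw [h.mem_iff_of_second_le (by omega) (by omega),
            h.mem_iff_of_second_le (by omega) (by omega),
            show k + 0 = k from rfl, show k + 1 - k = 0 + 1 by omega, show k - k = 0 by omega]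
          intro h1
          exact h1.trans_le (hl _ _)
        · obtain ⟨u, rfl⟩ := Nat.exists_eq_succ_of_ne_zero hu.ne'
          obtain ⟨v, rfl⟩ := Nat.exists_eq_succ_of_ne_zero hv.ne'
          rw [heightMem_iff_of_third_le (by omega) (by omega),
            heightMem_iff_of_third_le (by omega) (by omega),
            show k + u.succ - (k + 1) = u by omega, show k + v.succ - (k + 1) = v by omega,
            show k + u.succ - k = u + 1 by omega, show k + v.succ - k = v + 1 by omega]
          have := h.lineCount_le_succ_succ u v
          omega

theorem mem_of_mem_of_le (h : IsHeight m F) {i j k i' j' k' : ℕ} (hm : HeightMem m F i j k)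
    (hi : i' ≤ i) (hj : j' ≤ j) (hk : k' ≤ k) : HeightMem m F i' j' k' := by
  have h1 : HeightMem m F i' j k :=
    Nat.decreasingInduction (motive := fun i _ => HeightMem m F i j k)
      (fun i _ => (h.mem_of_mem_succ i j k).1) hm hi
  have h2 : HeightMem m F i' j' k :=
    Nat.decreasingInduction (motive := fun j _ => HeightMem m F i' j k)
      (fun j _ => (h.mem_of_mem_succ i' j k).2.1) h1 hj
  exact Nat.decreasingInduction (motive := fun k _ => HeightMem m F i' j' k)
      (fun k _ => (h.mem_of_mem_succ i' j' k).2.2) h2 hk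

theorem lt_of_mem (h : IsHeight m F) (i j k : ℕ) :
    HeightMem m F i j k → i < m ∧ j < m ∧ k < m := by
  refine rotation_induction (P := fun i j k => HeightMem m F i j k → i < m ∧ j < m ∧ k < m)
    ?_ ?_ i j k
  · intro i j k h1 h2
    rw [← h.mem_rotate] at h2
    have := h1 h2
    exact ⟨this.2.2, this.1, this.2.1⟩
  · intro i j k hi hj
    rw [heightMem_iff_of_third_le hi hj, lineCount]
    split_ifs
    · omega
    · have := h.le_sub (j - k - (i - k)) (j - k)
      omega

theorem mem_compl (h : IsHeight m F) (i j k : ℕ) : i < m → j < m → k < m →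
    (HeightMem m F i j k ↔ ¬ HeightMem m F (m - i - 1) (m - j - 1) (m - k - 1)) := by
  refine rotation_induction (P := fun i j k => i < m → j < m → k < m →
    (HeightMem m F i j k ↔ ¬ HeightMem m F (m - i - 1) (m - j - 1) (m - k - 1))) ?_ ?_ i j k
  · intro i j k h1 hk hi hj
    rw [← h.mem_rotate i j k, ← h.mem_rotate (m - i - 1) (m - j - 1)]
    exact h1 hi hj hk
  -- If `i, j ≥ k`, the smallest coordinate of the opposite point is the first or the second one.
  · intro i j k hki hkj hi hj hk
    rw [heightMem_iff_of_third_le hki hkj]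
    rcases le_or_gt j i with hji | hji
    · rw [h.mem_iff_of_first_le (by omega) (by omega), lineCount, lineCount, if_pos (by omega),
        show m - j - 1 - (m - i - 1) = i - j by omega,
        show m - k - 1 - (m - i - 1) = i - k by omega]
      split_ifs with hv
      · obtain rfl : j = k := by omega
        have := h.comp (i - j)
        rw [Nat.sub_self]
        omega
      · rw [show i - k - (i - j) = j - k by omega]
        have := h.le_sub (j - k) (i - k)
        omega
    · rw [h.mem_iff_of_second_le (by omega) (by omega), lineCount, lineCount, if_neg (by omega),
        show m - k - 1 - (m - j - 1) = j - k by omega,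
        show m - i - 1 - (m - j - 1) = j - i by omega, if_pos (by omega),
        show j - k - (i - k) = j - i by omega]
      have := h.le_sub (j - i) (j - k)
      omega

end IsHeight

/-! ### Cyclically symmetric, self-complementary plane partitions -/

/-- The condition counted by `CSSC m`. -/
def IsCSSC (m : ℕ) (π : Finset (ℕ × ℕ × ℕ)) : Prop :=
  IsPlanePartition π ∧ rotate π = π ∧ compl m m m π = π

theorem mem_rotate_iff (π : Finset (ℕ × ℕ × ℕ)) (i j k : ℕ) :
    (i, j, k) ∈ rotate π ↔ (k, i, j) ∈ π := by
  simp only [rotate, Finset.mem_image, Prod.mk.injEq, Prod.exists]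
  constructor
  · rintro ⟨a, b, c, h, rfl, rfl, rfl⟩
    exact h
  · intro h
    exact ⟨k, i, j, h, rfl, rfl, rfl⟩

theorem mem_box_iff (m i j k : ℕ) : (i, j, k) ∈ box m m m ↔ i < m ∧ j < m ∧ k < m := by
  simp [box]

theorem IsCSSC.mem_rotate {m : ℕ} {π : Finset (ℕ × ℕ × ℕ)} (h : IsCSSC m π) (i j k : ℕ) :
    (i, j, k) ∈ π ↔ (k, i, j) ∈ π := by
  have := mem_rotate_iff π i j k
  rwa [h.2.1] at this

theorem IsCSSC.mem_compl {m : ℕ} {π : Finset (ℕ × ℕ × ℕ)} (h : IsCSSC m π) {i j k : ℕ}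
    (hi : i < m) (hj : j < m) (hk : k < m) :
    (i, j, k) ∈ π ↔ (m - i - 1, m - j - 1, m - k - 1) ∉ π := by
  conv_lhs => rw [← h.2.2]
  rw [compl, Finset.mem_filter, mem_box_iff]
  exact and_iff_right ⟨hi, hj, hk⟩

theorem IsCSSC.lt {m : ℕ} {π : Finset (ℕ × ℕ × ℕ)} (h : IsCSSC m π) {i j k : ℕ}
    (hm : (i, j, k) ∈ π) : i < m ∧ j < m ∧ k < m := by
  rw [← h.2.2, compl, Finset.mem_filter, mem_box_iff] at hm
  exact hm.1

/-- The plane partition of the array `F`. -/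
noncomputable def ofHeight (m : ℕ) (F : ℕ → ℕ → ℕ) : Finset (ℕ × ℕ × ℕ) :=
  open Classical in (box m m m).filter fun p => HeightMem m F p.1 p.2.1 p.2.2

theorem IsHeight.mem_ofHeight {m : ℕ} {F : ℕ → ℕ → ℕ} (h : IsHeight m F) (i j k : ℕ) :
    (i, j, k) ∈ ofHeight m F ↔ HeightMem m F i j k := by
  classical
  rw [ofHeight, Finset.mem_filter, mem_box_iff]
  exact and_iff_right_of_imp (h.lt_of_mem i j k)

theorem IsHeight.isCSSC {m : ℕ} {F : ℕ → ℕ → ℕ} (h : IsHeight m F) : IsCSSC m (ofHeight m F) := by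
  refine ⟨?_, ?_, ?_⟩
  · intro i j k i' j' k' hm hi hj hk
    rw [h.mem_ofHeight] at hm ⊢
    exact h.mem_of_mem_of_le hm hi hj hk
  · ext ⟨i, j, k⟩
    rw [mem_rotate_iff, h.mem_ofHeight, h.mem_ofHeight, ← h.mem_rotate]
  · ext ⟨i, j, k⟩
    rw [compl, Finset.mem_filter, mem_box_iff, h.mem_ofHeight, h.mem_ofHeight]
    constructor
    · rintro ⟨⟨hi, hj, hk⟩, h1⟩
      exact (h.mem_compl i j k hi hj hk).mpr h1
    · intro h1
      obtain ⟨hi, hj, hk⟩ := h.lt_of_mem i j k h1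
      exact ⟨⟨hi, hj, hk⟩, (h.mem_compl i j k hi hj hk).mp h1⟩

/-- The array is determined by its plane partition. -/
theorem IsHeight.eq_of_ofHeight_eq {m : ℕ} {F G : ℕ → ℕ → ℕ} (hF : IsHeight m F)
    (hG : IsHeight m G) (h : ofHeight m F = ofHeight m G) (c a : ℕ) : F c a = G c a := by
  have key : ∀ c a, c ≤ a → F c a = G c a := by
    intro c a hca
    have h1 : ∀ t, t < m - a - F c a ↔ t < m - a - G c a := by
      intro t
      have h2 := Finset.ext_iff.mp h (a + t, c + t, t)
      rwa [hF.mem_ofHeight, hG.mem_ofHeight, heightMem_iff_of_third_le (by omega) (by omega),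
        heightMem_iff_of_third_le (by omega) (by omega), Nat.add_sub_cancel, Nat.add_sub_cancel,
        lineCount, lineCount, if_pos hca, if_pos hca] at h2
    have h2 := h1 (m - a - F c a)
    have h3 := h1 (m - a - G c a)
    have h4 := hF.le_sub c a
    have h5 := hG.le_sub c a
    omega
  rcases le_total c a with hca | hca
  · exact key c a hca
  · obtain ⟨d, rfl⟩ := Nat.exists_eq_add_of_le hca
    rw [hF.eq_diag, hG.eq_diag, key a a le_rfl]

namespace IsCSSC

variable {m : ℕ} {π : Finset (ℕ × ℕ × ℕ)}

theorem exists_notMem (h : IsCSSC m π) (u v : ℕ) : ∃ t, (u + t, v + t, t) ∉ π :=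
  ⟨m, fun hm => by have := (h.lt hm).2.2; omega⟩

open Classical in
/-- The number of points of `π` on the line `(u, v, 0) + ℕ(1, 1, 1)`. -/
noncomputable def height (h : IsCSSC m π) (u v : ℕ) : ℕ := Nat.find (h.exists_notMem u v)

theorem lt_height_iff (h : IsCSSC m π) (u v t : ℕ) : t < h.height u v ↔ (u + t, v + t, t) ∈ π := by
  classical
  constructor
  · intro ht
    exact not_not.mp (Nat.find_min (h.exists_notMem u v) ht)
  · intro ht
    by_contra hle
    have h1 : h.height u v ≤ t := not_lt.mp hle
    exact Nat.find_spec (h.exists_notMem u v)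
      (h.1 _ _ _ _ _ _ ht (Nat.add_le_add_left h1 u) (Nat.add_le_add_left h1 v) h1)

theorem height_le_sub (h : IsCSSC m π) (u v : ℕ) : h.height u v ≤ m - u := by
  by_contra hlt
  have h1 := (h.lt_height_iff u v (m - u)).mp (by omega)
  have := (h.lt h1).1
  omega

theorem height_le_height (h : IsCSSC m π) {u v u' v' : ℕ} (hu : u ≤ u') (hv : v ≤ v') :
    h.height u' v' ≤ h.height u v := by
  by_contra hlt
  have h1 := (h.lt_height_iff u' v' (h.height u v)).mp (by omega)
  have h2 := (h.lt_height_iff u v (h.height u v)).mpr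
    (h.1 _ _ _ _ _ _ h1 (by omega) (by omega) le_rfl)
  omega

theorem height_le_height_add_one (h : IsCSSC m π) {u v u' v' : ℕ} (hu : u' ≤ u + 1)
    (hv : v' ≤ v + 1) : h.height u v ≤ h.height u' v' + 1 := by
  by_contra hlt
  have h1 := (h.lt_height_iff u v (h.height u' v' + 1)).mp (by omega)
  have h2 := (h.lt_height_iff u' v' (h.height u' v')).mpr
    (h.1 _ _ _ _ _ _ h1 (by omega) (by omega) (by omega))
  omega

/-- The two symmetries carry the line `(a, 0, 0) + ℕ(1, 1, 1)` to the complement of `π` on the line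
`(a, a, 0) + ℕ(1, 1, 1)`. -/
theorem height_add_height (h : IsCSSC m π) {a : ℕ} (ha : a ≤ m) :
    h.height a 0 + h.height a a = m - a := by
  have h1 := h.height_le_sub a 0
  have h2 := h.height_le_sub a a
  have key : ∀ t, t < m - a → (t < h.height a 0 ↔ ¬ (m - a - t - 1 < h.height a a)) := by
    intro t ht
    rw [h.lt_height_iff, h.lt_height_iff, Nat.zero_add,
      h.mem_compl (by omega) (by omega) (by omega), 
      ← h.mem_rotate (m - t - 1) (m - t - 1) (m - (a + t) - 1),
      show m - (a + t) - 1 = m - a - t - 1 by omega,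
      show a + (m - a - t - 1) = m - t - 1 by omega]
  have h3 := key (h.height a 0)
  have h4 := key (h.height a 0 - 1)
  omega

/-- The array of a cyclically symmetric, self-complementary plane partition. The truncation
`min c a` accounts for the frozen particles. -/
noncomputable def toHeight (h : IsCSSC m π) (c a : ℕ) : ℕ := m - a - h.height a (min c a)

theorem isHeight_toHeight (h : IsCSSC m π) : IsHeight m h.toHeight where
  anti c a := by
    have := h.height_le_height_add_one (u := a) (v := min c a) (u' := a + 1) (v' := min c (a + 1))
      le_rfl (by omega)
    unfold toHeight
    omega
  drop c a := by
    have := h.height_le_height (u := a) (v := min c a) (u' := a + 1) (v' := min c (a + 1))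
      (by omega) (by omega)
    unfold toHeight
    omega
  mono c a := by
    have := h.height_le_height (u := a) (v := min c a) (u' := a) (v' := min (c + 1) a)
      le_rfl (by omega)
    unfold toHeight
    omega
  diag c a := by
    have := h.height_le_height_add_one (u := a) (v := min c a) (u' := a + 1)
      (v' := min (c + 1) (a + 1)) le_rfl (by omega)
    unfold toHeight
    omega
  frozen c a hac := by
    unfold toHeight
    rw [min_eq_right hac, min_eq_right (by omega)]
  comp a := by
    unfold toHeight
    rw [Nat.zero_min, min_self]
    by_cases ha : a ≤ m
    · have := h.height_add_height ha
      omega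
    · omega

theorem ofHeight_toHeight (h : IsCSSC m π) : ofHeight m h.toHeight = π := by
  have hH := h.isHeight_toHeight
  -- In the chamber `k ≤ j ≤ i` this is the definition; the symmetries yield the other chambers.
  have hchamber : ∀ i j k, k ≤ j → j ≤ i → (HeightMem m h.toHeight i j k ↔ (i, j, k) ∈ π) := by
    intro i j k hkj hji
    rw [heightMem_iff_of_third_le (hkj.trans hji) hkj, lineCount, if_pos (by omega), toHeight,
      min_eq_left (by omega)]
    have h1 := h.lt_height_iff (i - k) (j - k) k
    rw [Nat.sub_add_cancel (hkj.trans hji), Nat.sub_add_cancel hkj] at h1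
    rw [← h1]
    have := h.height_le_sub (i - k) (j - k)
    omega
  have hall : ∀ i j k, i < m → j < m → k < m →
      (HeightMem m h.toHeight i j k ↔ (i, j, k) ∈ π) := by
    intro i j k
    refine rotation_induction (P := fun i j k => i < m → j < m → k < m →
      (HeightMem m h.toHeight i j k ↔ (i, j, k) ∈ π)) ?_ ?_ i j k
    · intro i j k h1 hk hi hj
      rw [← hH.mem_rotate, ← h.mem_rotate]
      exact h1 hi hj hk
    · intro i j k hki hkj hi hj hk
      rcases le_or_gt j i with hji | hji
      · exact hchamber i j k hkj hji
      · rw [hH.mem_compl i j k hi hj hk, h.mem_compl hi hj hk, hH.mem_rotate, h.mem_rotate,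
          hchamber _ _ _ (by omega) (by omega)]
  ext ⟨i, j, k⟩
  rw [hH.mem_ofHeight]
  constructor
  · intro h1
    obtain ⟨hi, hj, hk⟩ := hH.lt_of_mem i j k h1
    exact (hall i j k hi hj hk).mp h1
  · intro h1
    obtain ⟨hi, hj, hk⟩ := h.lt h1
    exact (hall i j k hi hj hk).mpr h1

end IsCSSC

/-! ### The bijection with the path systems -/

section Bijection

variable {n : ℕ}

/-- The array of counting functions of a path system, continued constantly. -/
def pathHeight (s : Fin (n + n + 1) → (Fin n ↪o Fin (n + n))) (c a : ℕ) : ℕ :=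
  countGE (s ⟨min c (n + n), by omega⟩) a

theorem isHeight_pathHeight {s : Fin (n + n + 1) → (Fin n ↪o Fin (n + n))} (hs : IsSector s) :
    IsHeight (n + n) (pathHeight s) := by
  have hstep : ∀ c a, pathHeight s c a ≤ pathHeight s (c + 1) a ∧
      pathHeight s (c + 1) (a + 1) ≤ pathHeight s c a ∧
      (a ≤ c → pathHeight s (c + 1) a = pathHeight s c a) := by
    intro c a
    unfold pathHeight
    rcases lt_or_ge c (n + n) with hc | hc
    · obtain ⟨h1, h2, h3⟩ := step_iff_countGE.mp (hs.1 ⟨c, hc⟩)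
      simp only [min_eq_left hc.le, min_eq_left (Nat.succ_le_of_lt hc)]
      exact ⟨h1 a, h2 a, h3 a⟩
    · simp only [min_eq_right hc, min_eq_right (hc.trans (Nat.le_succ c))]
      exact ⟨le_rfl, countGE_succ_le _ _, fun _ => trivial⟩
  have hfrozen : ∀ c a, a ≤ c → pathHeight s (c + 1) a = pathHeight s c a :=
    fun c a => (hstep c a).2.2
  refine ⟨fun c a => countGE_succ_le _ _, fun c a => countGE_le_succ _ _,
    fun c a => (hstep c a).1, fun c a => (hstep c a).2.1, hfrozen, fun a => ?_⟩
  have h1 := (range_eq_compl_iff_countGE _ _).mp hs.2 a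
  have h2 : ∀ d, pathHeight s (a + d) a = pathHeight s a a := by
    intro d
    induction d with
    | zero => rfl
    | succ d ih => rw [← Nat.add_assoc, hfrozen _ _ (by omega), ih]
  have h3 : pathHeight s 0 a = countGE (s 0) a := by
    simp only [pathHeight, Nat.zero_min]
    rfl
  have h4 : pathHeight s (a + (n + n)) a = countGE (s (Fin.last (n + n))) a := by
    simp only [pathHeight, min_eq_right (Nat.le_add_left (n + n) a)]
    rfl
  rw [← h2 (n + n), h3, h4]
  exact h1

theorem exists_isSector {F : ℕ → ℕ → ℕ} (hF : IsHeight (n + n) F) :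
    ∃ s : Fin (n + n + 1) → (Fin n ↪o Fin (n + n)), IsSector s ∧ ∀ c a, c ≤ n + n →
      pathHeight s c a = F c a := by
  -- The number of particles is forced by `F 0 0 + F 0 0 = n + n`.
  have h0 : ∀ c, F c 0 = n := by
    intro c
    have h1 := hF.comp 0
    have h2 := hF.eq_diag 0 c
    rw [Nat.zero_add] at h2
    omega
  have hm : ∀ c a, n + n ≤ a → F c a = 0 := by
    intro c a ha
    have := hF.le_sub c a
    omega
  choose x hx using fun c : ℕ => exists_countGE_eq (n := n) (m := n + n) (F c) (h0 c) (hm c)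
    (hF.anti c) (hF.drop c)
  refine ⟨fun i => x i, ⟨fun i => ?_, ?_⟩, fun c a hc => ?_⟩
  · rw [step_iff_countGE]
    simp only [hx, Fin.val_castSucc, Fin.val_succ]
    exact ⟨hF.mono i, hF.diag i, hF.frozen i⟩
  · rw [range_eq_compl_iff_countGE]
    intro a
    simp only [hx, Fin.val_zero, Fin.val_last]
    rw [← hF.comp a]
    congr 1
    rcases le_total a (n + n) with ha | ha
    · obtain ⟨d, hd⟩ := Nat.exists_eq_add_of_le ha
      rw [hd, hF.eq_diag]
    · rw [hm _ a ha, hm _ a ha]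
  · simp only [pathHeight, hx, min_eq_left hc]

open Classical in
theorem card_isSector_eq_CSSC (n : ℕ) :
    (univ.filter (IsSector (n := n))).card = CSSC (n + n) := by
  unfold CSSC
  refine Finset.card_bij (fun s _ => ofHeight (n + n) (pathHeight s)) ?_ ?_ ?_
  · intro s hs
    have h := (isHeight_pathHeight (Finset.mem_filter.mp hs).2).isCSSC
    exact Finset.mem_filter.mpr ⟨Finset.mem_powerset.mpr (Finset.filter_subset _ _), h⟩
  · intro s hs t ht hst
    have h := IsHeight.eq_of_ofHeight_eq (isHeight_pathHeight (Finset.mem_filter.mp hs).2)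
      (isHeight_pathHeight (Finset.mem_filter.mp ht).2) hst
    funext i
    refine countGE_injective fun a => ?_
    have h1 := h i a
    simpa only [pathHeight, min_eq_left (Nat.lt_succ_iff.mp i.2)] using h1
  · intro π hπ
    have h : IsCSSC (n + n) π := (Finset.mem_filter.mp hπ).2
    obtain ⟨s, hs, hsF⟩ := exists_isSector h.isHeight_toHeight
    refine ⟨s, Finset.mem_filter.mpr ⟨Finset.mem_univ _, hs⟩, ?_⟩
    have h1 : pathHeight s = h.toHeight := by
      have hH := isHeight_pathHeight hs
      have hT := h.isHeight_toHeight
      funext c a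
      rcases le_total c a with hca | hca
      · rcases le_total c (n + n) with hc | hc
        · exact hsF c a hc
        · have h2 := hH.le_sub c a
          have h3 := hT.le_sub c a
          omega
      · obtain ⟨d, rfl⟩ := Nat.exists_eq_add_of_le hca
        rw [hH.eq_diag, hT.eq_diag]
        rcases le_total a (n + n) with ha | ha
        · exact hsF a a ha
        · have h2 := hH.le_sub a a
          have h3 := hT.le_sub a a
          omega
    rw [h1, h.ofHeight_toHeight]

end Bijection

end PlanePartition

theorem proposition2p2 (n : ℕ) :
    (PlanePartition.CSSC (2 * n) : ℚ) = 2 ^ n * (PlanePartition.U n).det := by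
  classical
  rw [two_mul, ← PlanePartition.card_isSector_eq_CSSC, ← PlanePartition.card_isSector]
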